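/- Let $1<R<\infty$ and $\mathbb A=A(1,R)=\{z\in\mathbb C:1<|z|<R\}$. Let $\mathcal H(\mathbb A,\ast)$ be the class of sense-preserving homeomorphisms $h$ of $\mathbb A$ onto some doubly connected domain $\Omega\subset\mathbb C$ whose inner boundary is the unit circle (the complement of $\Omega$ in the Riemann sphere has exactly two connected components: the closed unit disk and a component containing $\infty$, otherwise arbitrary), which preserve the order of the boundary components, i.e. $|h(z)|\to1$ as $|z|\searrow1$. For $1<\rho<R$ put $$U(\rho)=\frac1{2\pi\rho}\int_{|z|=\rho}|h(z)|^2\,|dz| .$$ If $h\in\mathcal H(\mathbb A,\ast)$ is conformal (holomorphic in $\mathbb A$), then the initial speed of $h$ equals $1$: $$\lim_{\rho\searrow1}\frac{d}{d\rho}\,U(\rho)^{1/2}=1 .$$ Moreover, $U$ is twice continuously differentiable on $(1,R)$ and, for every $\rho\in(1,R)$, $$U(\rho)\ge\rho^2,\qquad U'(\rho)\ge2\rho,\qquad U''(\rho)\ge2 .$$ At any given $\rho\in(1,R)$, equality holds in any one of these three inequalities if and only if $h(z)=\lambda z$ for all $z\in\mathbb A$, for some constant $\lambda$ with $|\lambda|=1$.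 -/

import Mathlib

open Set Filter Topology

noncomputable section

namespace CircleEvolution

/-- The open circular annulus `A(r, R) = {z : r < |z| < R}`. -/
def annulus (r R : ℝ) : Set ℂ := {z : ℂ | r < ‖z‖ ∧ ‖z‖ < R}

/-- A half circular annulus with inner boundary the unit circle: a planar domain `Ω` whose
complement in the Riemann sphere has exactly two connected components (that is, `Ω` is doubly
connected), namely the closed unit disk and a component `L` that contains `∞`. Since the closed
disk and `L` are closed, disjoint and connected, they are the components of their union. Nothing is
prescribed about the shape of `L`, that is, about the outer boundary of `Ω`. -/
def IsHalfCircularAnnulus (Ω : Set ℂ) : Prop :=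
  IsOpen Ω ∧ IsConnected Ω ∧
    ∃ L : Set (OnePoint ℂ), IsClosed L ∧ IsConnected L ∧ OnePoint.infty ∈ L ∧
      Disjoint ((fun w : ℂ => (w : OnePoint ℂ)) '' Metric.closedBall 0 1) L ∧
      ((fun w : ℂ => (w : OnePoint ℂ)) '' Ω)ᶜ =
        (fun w : ℂ => (w : OnePoint ℂ)) '' Metric.closedBall 0 1 ∪ L

/-- `h` is sense-preserving on `A`: for every closed disk in `A`, the image under `h` of its
positively oriented boundary circle has winding number `1` about the image of the centre. The
function `φ` is a continuous branch of `arg (h - h z)` along the circle. -/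
def SensePreservingOn (h : ℂ → ℂ) (A : Set ℂ) : Prop :=
  ∀ z : ℂ, ∀ s : ℝ, 0 < s → Metric.closedBall z s ⊆ A →
    ∃ φ : ℝ → ℝ, Continuous φ ∧
      (∀ t : ℝ, h (circleMap z s t) ≠ h z ∧
        h (circleMap z s t) - h z =
          (‖h (circleMap z s t) - h z‖ : ℂ) * Complex.exp ((φ t : ℂ) * Complex.I)) ∧
      φ (2 * Real.pi) - φ 0 = 2 * Real.pi

/-- The class `H(A, *)`, `A = A(1, R)`: sense-preserving homeomorphisms `h` of `A` onto some half
circular annulus `Ω` (inner boundary the unit circle) which preserve the order of the boundary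
components. As `h` is a homeomorphism onto `Ω`, the order is preserved exactly when `h(z)` tends
to the inner boundary of `Ω`, that is `|h(z)| → 1`, as `|z| ↘ 1` (the outer boundary components
then correspond too). Only the values of `h` on `A` matter. -/
def HomeoClass (R : ℝ) (h : ℂ → ℂ) : Prop :=
  ∃ Ω : Set ℂ, IsHalfCircularAnnulus Ω ∧
    (∃ e : annulus 1 R ≃ₜ Ω, ∀ z : annulus 1 R, (e z : ℂ) = h z) ∧
    SensePreservingOn h (annulus 1 R) ∧
    Tendsto (fun z : ℂ => ‖h z‖) (comap (fun z : ℂ => ‖z‖) (𝓝[>] (1 : ℝ))) (𝓝 1)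

/-- The circular mean `U(ρ)` of `|h|²` over the circle `|z| = ρ`. -/
def circularMean (h : ℂ → ℂ) (ρ : ℝ) : ℝ :=
  Real.circleAverage (fun z : ℂ => ‖h z‖ ^ 2) 0 ρ

/-- The mean radius `√U(ρ)` of the image of the circle `|z| = ρ`. -/
def meanRadius (h : ℂ → ℂ) (ρ : ℝ) : ℝ := Real.sqrt (circularMean h ρ)

/-- The initial speed of `h` exists and equals `v`: the mean radius is differentiable at all
`ρ > 1` close to `1`, and its derivative tends to `v` as `ρ ↘ 1`. -/
def HasInitialSpeed (h : ℂ → ℂ) (v : ℝ) : Prop :=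
  (∀ᶠ ρ in 𝓝[>] (1 : ℝ), DifferentiableAt ℝ (meanRadius h) ρ) ∧
    Tendsto (deriv (meanRadius h)) (𝓝[>] (1 : ℝ)) (𝓝 v)

/-- On `A(1, R)` the map `h` is a rotation `h(z) = λ z`, `|λ| = 1`. -/
def IsRotationOn (R : ℝ) (h : ℂ → ℂ) : Prop :=
  ∃ l : ℂ, ‖l‖ = 1 ∧ ∀ z ∈ annulus 1 R, h z = l * z

end CircleEvolution

end

/-! Expanding `h` in a Laurent series with coefficients `a n`, Parseval gives U(ρ) = W(ρ²), where
W(x) = ∑ |a n|² xⁿ. Since n(n - 1) ≥ 0 for every integer n, W'' ≥ 0, so W' is increasing. Everything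
therefore follows once W and W' both tend to 1 at 1: then W' ≥ 1 and W(x) ≥ x, while U' = 2ρW' and
U'' = 2W' + 4ρ²W'' at x = ρ². The initial speed is the limit of 2ρW' / (2√W).

The limit of W' is where the geometry enters. The argument principle shows that the image of each
circle winds once about 0 (`circleIntegral_logDeriv_of_injOn`). The radial derivative of the mean of
log‖h‖ is thus 1/ρ, and since ‖h‖ → 1 at the inner circle the mean equals log ρ
(`circleAverage_log_norm_eq_log`). Near that circle ‖h‖² - 1 is comparable to log‖h‖² with constant
tending to 1, so W(x) - 1 is asymptotic to log x (`circularMean_sub_one_bounds`), and monotonicity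
of W' turns this into W' → 1.

Each equality forces W'' = 0 somewhere. Then only the coefficients of index 0 and 1 survive, and the
limits at 1 leave W(x) = x, so `h` is a rotation. -/

namespace CircleEvolution

/-! ### Termwise differentiation of two-sided power series -/

/-- The two-sided power series with real coefficients `c`. -/
noncomputable def laurentSum (c : ℤ → ℝ) (x : ℝ) : ℝ := ∑' n, c n * x ^ n

/-- The coefficients of the termwise derivative of a two-sided power series. -/
def laurentDeriv (c : ℤ → ℝ) (n : ℤ) : ℝ := (n + 1 : ℤ) * c (n + 1)

/-- The tangent-line inequalities for the convex function `x ↦ x ^ n`. -/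
lemma abs_mul_zpow_sub_one_le {p s x t q : ℝ} (hp : 0 < p) (hps : p < s) (hsx : s ≤ x)
    (hxt : x ≤ t) (htq : t < q) (n : ℤ) :
    |(n : ℝ) * x ^ (n - 1)| ≤ (q - t)⁻¹ * q ^ n + (s - p)⁻¹ * p ^ n := by
  have hx : 0 < x := by linarith
  have hq : 0 < q := by linarith
  have hd := hasDerivAt_zpow n x (Or.inl hx.ne')
  have h1 := (convexOn_zpow (𝕜 := ℝ) n).le_slope_of_hasDerivAt (mem_Ioi.2 hx) (mem_Ioi.2 hq)
    (by linarith) hd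
  have h2 := (convexOn_zpow (𝕜 := ℝ) n).slope_le_of_hasDerivAt (mem_Ioi.2 hp) (mem_Ioi.2 hx)
    (by linarith) hd
  rw [slope_def_field] at h1 h2
  have e1 : (q ^ n - x ^ n) / (q - x) ≤ (q - t)⁻¹ * q ^ n := by
    rw [div_eq_mul_inv, mul_comm]
    have : (q - x)⁻¹ ≤ (q - t)⁻¹ := by
      apply inv_anti₀ <;> linarith
    have h0 : 0 ≤ (q - x)⁻¹ := by
      apply inv_nonneg.2; linarith
    have := zpow_pos hx n
    have := zpow_pos hq n
    calc (q - x)⁻¹ * (q ^ n - x ^ n) ≤ (q - x)⁻¹ * q ^ n := by gcongr; linarith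
      _ ≤ _ := by gcongr
  have e2 : -((s - p)⁻¹ * p ^ n) ≤ (x ^ n - p ^ n) / (x - p) := by
    rw [div_eq_mul_inv, mul_comm (x ^ n - p ^ n)]
    have : (x - p)⁻¹ ≤ (s - p)⁻¹ := by
      apply inv_anti₀ <;> linarith
    have h0 : 0 ≤ (x - p)⁻¹ := by
      apply inv_nonneg.2; linarith
    have := zpow_pos hx n
    have := zpow_pos hp n
    calc -((s - p)⁻¹ * p ^ n) ≤ -((x - p)⁻¹ * p ^ n) := by gcongr
      _ = (x - p)⁻¹ * (-p ^ n) := by ring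
      _ ≤ _ := by gcongr; linarith
  have p1 : 0 ≤ (q - t)⁻¹ * q ^ n := by
    have : 0 < q - t := by linarith
    positivity
  have p2 : 0 ≤ (s - p)⁻¹ * p ^ n := by
    have : 0 < s - p := by linarith
    positivity
  rw [abs_le]
  constructor <;> linarith

lemma laurentDeriv_shift (c : ℤ → ℝ) (x : ℝ) (n : ℤ) :
    laurentDeriv c (Equiv.subRight 1 n) * x ^ (Equiv.subRight 1 n) =
      c n * (n * x ^ (n - 1)) := by
  simp [laurentDeriv]
  ring

/-- With p < s < x < t < q, the tangent-line bounds majorize the differentiated terms on (s, t) by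
multiples of the terms at p and q, which are absolutely summable. -/
lemma laurentSum_aux {c : ℤ → ℝ} {a b x : ℝ} (ha : 0 ≤ a)
    (hc : ∀ y ∈ Ioo a b, Summable fun n => c n * y ^ n) (hx : x ∈ Ioo a b) :
    Summable (fun n => laurentDeriv c n * x ^ n) ∧
      HasDerivAt (laurentSum c) (laurentSum (laurentDeriv c) x) x := by
  obtain ⟨s, has, hsx⟩ := exists_between hx.1
  obtain ⟨p, hap, hps⟩ := exists_between has
  obtain ⟨t, hxt, htb⟩ := exists_between hx.2
  obtain ⟨q, htq, hqb⟩ := exists_between htb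
  have hp0 : 0 < p := by linarith
  have hq0 : 0 < q := by linarith
  set u : ℤ → ℝ := fun n =>
    (q - t)⁻¹ * |c n * q ^ n| + (s - p)⁻¹ * |c n * p ^ n| with hu
  have hus : Summable u :=
    ((hc q ⟨by linarith, hqb⟩).abs.mul_left _).add ((hc p ⟨hap, by linarith⟩).abs.mul_left _)
  have hbound : ∀ n : ℤ, ∀ y ∈ Ioo s t, ‖c n * (n * y ^ (n - 1))‖ ≤ u n := by
    intro n y hy
    rw [norm_mul, Real.norm_eq_abs, Real.norm_eq_abs]
    have := abs_mul_zpow_sub_one_le hp0 hps hy.1.le hy.2.le htq n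
    simp only [hu, abs_mul]
    rw [abs_of_pos (zpow_pos hq0 n), abs_of_pos (zpow_pos hp0 n)]
    calc |c n| * (|(n : ℝ)| * |y ^ (n - 1)|) ≤
        |c n| * ((q - t)⁻¹ * q ^ n + (s - p)⁻¹ * p ^ n) := by
          rw [← abs_mul]; gcongr
      _ = _ := by ring
  have hmem : x ∈ Ioo s t := ⟨hsx, hxt⟩
  have hsum : Summable fun n : ℤ => c n * (n * x ^ (n - 1)) :=
    .of_norm_bounded hus fun n => hbound n x hmem
  have key := hasDerivAt_tsum_of_isPreconnected (g := fun (n : ℤ) (y : ℝ) => c n * y ^ n) hus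
    isOpen_Ioo isPreconnected_Ioo
    (fun n y hy => (hasDerivAt_zpow n y (Or.inl (by linarith [hy.1]))).const_mul (c n))
    hbound hmem (hc x hx) hmem
  constructor
  · rw [← (Equiv.subRight (1 : ℤ)).summable_iff]
    exact hsum.congr fun n => (laurentDeriv_shift c x n).symm
  · have : laurentSum (laurentDeriv c) x = ∑' n : ℤ, c n * (n * x ^ (n - 1)) := by
      rw [laurentSum, ← (Equiv.subRight (1 : ℤ)).tsum_eq]
      exact tsum_congr fun n => laurentDeriv_shift c x n
    rw [this]
    exact key

lemma summable_laurentDeriv {c : ℤ → ℝ} {a b x : ℝ} (ha : 0 ≤ a)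
    (hc : ∀ y ∈ Ioo a b, Summable fun n => c n * y ^ n) (hx : x ∈ Ioo a b) :
    Summable (fun n => laurentDeriv c n * x ^ n) := (laurentSum_aux ha hc hx).1

lemma hasDerivAt_laurentSum {c : ℤ → ℝ} {a b x : ℝ} (ha : 0 ≤ a)
    (hc : ∀ y ∈ Ioo a b, Summable fun n => c n * y ^ n) (hx : x ∈ Ioo a b) :
    HasDerivAt (laurentSum c) (laurentSum (laurentDeriv c) x) x := (laurentSum_aux ha hc hx).2

/-- The factor (n + 1)(n + 2) is a product of consecutive integers, hence never negative, even for
negative n. This is the source of all the convexity. -/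
lemma laurentDeriv_laurentDeriv_nonneg {c : ℤ → ℝ} (hc : ∀ n, 0 ≤ c n) (n : ℤ) :
    0 ≤ laurentDeriv (laurentDeriv c) n := by
  rw [laurentDeriv, laurentDeriv, ← mul_assoc, ← Int.cast_mul]
  refine mul_nonneg (Int.cast_nonneg ?_) (hc _)
  rcases le_or_gt 0 (n + 1) with h | h
  · exact mul_nonneg h (by omega)
  · exact mul_nonneg_of_nonpos_of_nonpos h.le (by omega)

lemma laurentSum_nonneg {c : ℤ → ℝ} (hc : ∀ n, 0 ≤ c n) {x : ℝ} (hx : 0 ≤ x) :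
    0 ≤ laurentSum c x := tsum_nonneg fun n => mul_nonneg (hc n) (zpow_nonneg hx n)

/-- A two-sided power series with nonnegative coefficients whose second derivative vanishes at a
point is an affine function. -/
lemma eq_zero_of_laurentSum_laurentDeriv_laurentDeriv_eq_zero {c : ℤ → ℝ} (hc : ∀ n, 0 ≤ c n)
    {x : ℝ} (hx : 0 < x) (hs : Summable fun n => laurentDeriv (laurentDeriv c) n * x ^ n)
    (h0 : laurentSum (laurentDeriv (laurentDeriv c)) x = 0) {n : ℤ} (hn0 : n ≠ 0) (hn1 : n ≠ 1) :
    c n = 0 := by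
  have hterm := (hs.hasSum_iff.2 h0)
  rw [hasSum_zero_iff_of_nonneg fun n =>
    mul_nonneg (laurentDeriv_laurentDeriv_nonneg hc n) (zpow_nonneg hx.le n)] at hterm
  -- Two differentiations shift the index by two: the term at n - 2 carries n(n - 1) c n.
  have := congrFun hterm (n - 2)
  have hxn : x ^ (n - 2) ≠ 0 := (zpow_pos hx _).ne'
  have e : n - 2 + 1 = n - 1 := by ring
  have e' : n - 1 + 1 = n := by ring
  have i1 : ((n - 1 : ℤ) : ℝ) ≠ 0 := Int.cast_ne_zero.2 (sub_ne_zero.2 hn1)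
  have i0 : ((n : ℤ) : ℝ) ≠ 0 := Int.cast_ne_zero.2 hn0
  simpa [laurentDeriv, e, e', hxn, i1, i0, -Int.cast_sub] using this

/-! ### Circle integrals on an annulus and the winding number -/

lemma isOpen_annulus (r R : ℝ) : IsOpen (annulus r R) :=
  (isOpen_lt continuous_const continuous_norm).inter (isOpen_lt continuous_norm continuous_const)

lemma closedBall_diff_ball_subset_annulus {r R s t : ℝ} (hs : r < s) (ht : t < R) :
    Metric.closedBall (0 : ℂ) t \ Metric.ball 0 s ⊆ annulus r R := by
  rintro z ⟨h1, h2⟩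
  simp only [Metric.mem_closedBall, Metric.mem_ball, dist_zero_right, not_lt] at h1 h2
  exact ⟨hs.trans_le h2, h1.trans_lt ht⟩

lemma sphere_subset_annulus {r R ρ : ℝ} (h : ρ ∈ Ioo r R) :
    Metric.sphere (0 : ℂ) ρ ⊆ annulus r R := by
  intro z hz
  rw [mem_sphere_zero_iff_norm] at hz
  exact ⟨hz ▸ h.1, hz ▸ h.2⟩

/-- Circle integrals of a holomorphic function on an annulus do not depend on the radius. -/
lemma circleIntegral_eq_of_annulus {f : ℂ → ℂ} {r R : ℝ} (hr : 0 ≤ r)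
    (hf : DifferentiableOn ℂ f (annulus r R)) {s t : ℝ} (hs : s ∈ Ioo r R) (ht : t ∈ Ioo r R) :
    (∮ z in C(0, s), f z) = ∮ z in C(0, t), f z := by
  wlog hst : s ≤ t generalizing s t
  · exact (this ht hs (le_of_not_ge hst)).symm
  have hsub := closedBall_diff_ball_subset_annulus hs.1 ht.2
  refine (Complex.circleIntegral_eq_of_differentiable_on_annulus_off_countable
    (hr.trans_lt hs.1) hst countable_empty (hf.continuousOn.mono hsub) ?_).symm
  rintro z ⟨⟨h1, h2⟩, -⟩
  exact hf.differentiableAt ((isOpen_annulus r R).mem_nhds (hsub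
    ⟨Metric.ball_subset_closedBall h1, fun h => h2 (Metric.ball_subset_closedBall h)⟩))

/-- Circle averages of a holomorphic function on an annulus do not depend on the radius. -/
lemma circleAverage_eq_of_annulus {f : ℂ → ℂ} {r R : ℝ} (hr : 0 ≤ r)
    (hf : DifferentiableOn ℂ f (annulus r R)) {s t : ℝ} (hs : s ∈ Ioo r R) (ht : t ∈ Ioo r R) :
    Real.circleAverage f 0 s = Real.circleAverage f 0 t := by
  have hd : DifferentiableOn ℂ (fun z => (z - 0)⁻¹ • f z) (annulus r R) := by
    intro z hz
    have h0 : z - 0 ≠ 0 := by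
      rw [sub_zero]
      exact norm_pos_iff.1 (hr.trans_lt hz.1)
    have h1 : DifferentiableAt ℂ (fun z : ℂ => (z - 0)⁻¹) z := .fun_inv (by fun_prop) h0
    exact h1.differentiableWithinAt.fun_smul (hf z hz)
  rw [Real.circleAverage_eq_circleIntegral (hr.trans_lt hs.1).ne',
    Real.circleAverage_eq_circleIntegral (hr.trans_lt ht.1).ne',
    circleIntegral_eq_of_annulus hr hd hs ht]

/-- A function with values in the slit plane has winding number zero about the origin. -/
lemma circleIntegral_logDeriv_eq_zero {F F' : ℂ → ℂ} {ρ : ℝ} (hρ : 0 ≤ ρ)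
    (hF : ∀ z ∈ Metric.sphere (0 : ℂ) ρ, HasDerivAt F (F' z) z)
    (hslit : ∀ z ∈ Metric.sphere (0 : ℂ) ρ, F z ∈ Complex.slitPlane) :
    (∮ z in C(0, ρ), F' z / F z) = 0 :=
  circleIntegral.integral_eq_zero_of_hasDerivWithinAt hρ fun z hz =>
    ((hF z hz).clog (hslit z hz)).hasDerivWithinAt

lemma one_sub_mem_slitPlane {w : ℂ} (hw : ‖w‖ < 1) : 1 - w ∈ Complex.slitPlane := by
  rw [sub_eq_add_neg]
  exact Complex.mem_slitPlane_of_norm_lt_one (by simpa using hw)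

/-- The winding number about the origin of the image of a circle under an injective holomorphic map
of an annulus onto a domain whose inner boundary is the unit circle. -/
theorem circleIntegral_logDeriv_of_injOn {R : ℝ} {h : ℂ → ℂ}
    (hd : DifferentiableOn ℂ h (annulus 1 R)) (hinj : InjOn h (annulus 1 R))
    (hgt : ∀ z ∈ annulus 1 R, 1 < ‖h z‖)
    (hlim : Tendsto (fun z : ℂ => ‖h z‖) (comap (fun z : ℂ => ‖z‖) (𝓝[>] (1 : ℝ))) (𝓝 1))
    {ρ : ℝ} (hρ : ρ ∈ Ioo 1 R) :
    (∮ z in C(0, ρ), deriv h z / h z) = 2 * Real.pi * Complex.I := by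
  have hopen := isOpen_annulus 1 R
  have hsmall : ∀ m : ℝ, 1 < m → ∃ δ > 1, ∀ z : ℂ, 1 < ‖z‖ → ‖z‖ < δ → ‖h z‖ < m := by
    intro m hm
    have := hlim.eventually (gt_mem_nhds hm)
    rw [eventually_comap, eventually_nhdsWithin_iff] at this
    obtain ⟨δ, hδ, H⟩ := exists_Ico_subset_of_mem_nhds this ⟨2, by norm_num⟩
    exact ⟨δ, hδ, fun z h1 h2 => H ⟨h1.le, h2⟩ h1 z rfl⟩
  have hdAt : ∀ z ∈ annulus 1 R, HasDerivAt h (deriv h z) z := fun z hz =>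
    (hd.differentiableAt (hopen.mem_nhds hz)).hasDerivAt
  have hsub := sphere_subset_annulus hρ
  -- The minimum of ‖h‖ on the circle of radius ρ exceeds 1, so points close enough to the inner
  -- circle have images of smaller modulus than the whole image of that circle.
  obtain ⟨zm, hzm, hmin⟩ := (isCompact_sphere (0 : ℂ) ρ).exists_isMinOn
    (NormedSpace.sphere_nonempty.2 (by linarith [hρ.1]))
    ((hd.continuousOn.mono hsub).norm)
  obtain ⟨δ, hδ, hδh⟩ := hsmall _ (hgt zm (hsub hzm))
  -- a point close to the inner boundary where the derivative does not vanish
  obtain ⟨z₀, hz₀, hz₀ρ, hz₀δ, hz₀d⟩ : ∃ z₀ ∈ annulus 1 R, ‖z₀‖ < ρ ∧ ‖z₀‖ < δ ∧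
      deriv h z₀ ≠ 0 := by
    by_contra! H
    obtain ⟨x, hx1, hx2⟩ := exists_between (lt_min hρ.1 hδ)
    rw [lt_min_iff] at hx2
    have hball : ∀ᶠ y in 𝓝 (x : ℂ), y ∈ annulus 1 (min ρ δ) :=
      (isOpen_annulus _ _).mem_nhds (by
        simp [annulus, abs_of_pos (zero_lt_one.trans hx1), hx1, hx2])
    obtain ⟨ε, hε, hεb⟩ := Metric.eventually_nhds_iff_ball.1 hball
    have hmem : ∀ y ∈ Metric.ball (x : ℂ) ε, y ∈ annulus 1 R := fun y hy =>
      ⟨(hεb y hy).1, ((hεb y hy).2.trans_le (min_le_left _ _)).trans hρ.2⟩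
    have hconst : ∀ y ∈ Metric.ball (x : ℂ) ε, h y = h x := by
      intro y hy
      refine Metric.isOpen_ball.is_const_of_deriv_eq_zero
        (convex_ball (x : ℂ) ε).isPreconnected (hd.mono hmem) ?_ hy (Metric.mem_ball_self hε)
      intro z hz
      have := (hεb z hz).2
      rw [lt_min_iff] at this
      exact H z (hmem z hz) this.1 this.2
    have hy : (x : ℂ) + (ε / 2 : ℝ) ∈ Metric.ball (x : ℂ) ε := by
      rw [Metric.mem_ball, dist_self_add_left, Complex.norm_real, Real.norm_eq_abs,
        abs_of_pos (by linarith)]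
      linarith
    have := hinj (hmem _ hy) (hmem _ (Metric.mem_ball_self hε)) (hconst _ hy)
    rw [add_eq_left, Complex.ofReal_eq_zero] at this
    linarith
  set w := h z₀ with hw
  have hw1 : 1 < ‖w‖ := hgt z₀ hz₀
  have hw0 : w ≠ 0 := norm_pos_iff.1 (by linarith)
  -- The radius r is chosen so that ‖h‖ < ‖w‖ on |z| = r, with z₀ strictly between the circles of
  -- radii r and ρ.
  obtain ⟨η, hη, hηh⟩ := hsmall _ hw1
  obtain ⟨r, hr1, hr2⟩ := exists_between (lt_min hz₀.1 hη)
  rw [lt_min_iff] at hr2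
  have hrR : r ∈ Ioo 1 R := ⟨hr1, hr2.1.trans hz₀.2⟩
  have hsubr := sphere_subset_annulus hrR
  -- the factorization `h z - w = (z - z₀) * k z`
  set k := dslope h z₀ with hk
  have hkd : DifferentiableOn ℂ k (annulus 1 R) :=
    (Complex.differentiableOn_dslope (hopen.mem_nhds hz₀)).2 hd
  have hfac : ∀ z, h z - w = (z - z₀) * k z := fun z => (sub_smul_dslope h z₀ z).symm
  have hk0 : ∀ z ∈ annulus 1 R, k z ≠ 0 := by
    intro z hz
    rcases eq_or_ne z z₀ with rfl | hne
    · rwa [hk, dslope_same]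
    · intro h0
      have := hfac z
      rw [h0, mul_zero, sub_eq_zero] at this
      exact hne (hinj hz hz₀ this)
  have hkAt : ∀ z ∈ annulus 1 R, HasDerivAt k (deriv k z) z := fun z hz =>
    (hkd.differentiableAt (hopen.mem_nhds hz)).hasDerivAt
  have hq : DifferentiableOn ℂ (fun z => deriv k z / k z) (annulus 1 R) :=
    (hkd.deriv hopen).div hkd hk0
  have hlog : ∀ z ∈ annulus 1 R, z ≠ z₀ →
      deriv h z / (h z - w) = (z - z₀)⁻¹ + deriv k z / k z := by
    intro z hz hne
    have h1 : HasDerivAt (fun z => (z - z₀) * k z) (1 * k z + (z - z₀) * deriv k z) z :=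
      ((hasDerivAt_id z).sub_const z₀).mul (hkAt z hz)
    have h2 : HasDerivAt (fun z => (z - z₀) * k z) (deriv h z) z := by
      simpa only [hfac] using (hdAt z hz).sub_const w
    rw [h2.unique h1, hfac]
    have := hk0 z hz
    have := sub_ne_zero.2 hne
    field_simp
  have hci : ∀ {s : ℝ}, s ∈ Ioo 1 R → CircleIntegrable (fun z => deriv k z / k z) 0 s :=
    fun {s} hs => (hq.continuousOn.mono (sphere_subset_annulus hs)).circleIntegrable
      (by linarith [hs.1])
  have hi : ∀ {s : ℝ}, s ∈ Ioo 1 R → s ≠ ‖z₀‖ → (∮ z in C(0, s), deriv h z / (h z - w)) =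
      (∮ z in C(0, s), (z - z₀)⁻¹) + ∮ z in C(0, s), deriv k z / k z := by
    intro s hs hne
    have hs0 : 0 ≤ s := by linarith [hs.1]
    rw [← circleIntegral.integral_add _ (hci hs)]
    · refine circleIntegral.integral_congr hs0 fun z hz => ?_
      refine hlog z (sphere_subset_annulus hs hz) ?_
      rintro rfl
      exact hne (mem_sphere_zero_iff_norm.1 hz).symm
    · refine circleIntegrable_sub_inv_iff.2 (Or.inr ?_)
      rw [abs_of_nonneg hs0, mem_sphere_zero_iff_norm]
      exact hne.symm
  have hr0 : (0 : ℝ) ≤ r := by linarith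
  have hρ0 : (0 : ℝ) ≤ ρ := by linarith [hρ.1]
  have hout : (∮ z in C(0, ρ), (z - z₀)⁻¹) = 2 * Real.pi * Complex.I :=
    circleIntegral.integral_sub_inv_of_mem_ball (by simpa using hz₀ρ)
  have hin : (∮ z in C(0, r), (z - z₀)⁻¹) = 0 := by
    have hne : ∀ z ∈ Metric.closedBall (0 : ℂ) r, z - z₀ ≠ 0 := by
      intro z hz h0
      rw [sub_eq_zero] at h0
      rw [mem_closedBall_zero_iff, h0] at hz
      linarith [hr2.1]
    refine Complex.circleIntegral_eq_zero_of_differentiable_on_off_countable hr0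
      countable_empty ?_ ?_
    · exact ContinuousOn.inv₀ (by fun_prop) hne
    · rintro z ⟨hz, -⟩
      have h1 : DifferentiableAt ℂ (fun z : ℂ => (z - z₀)⁻¹) z :=
        .fun_inv (by fun_prop) (hne z (Metric.ball_subset_closedBall hz))
      exact h1
  -- On the inner circle h - w = -w(1 - h/w), and 1 - h/w has a holomorphic logarithm.
  have hzero : (∮ z in C(0, r), deriv h z / (h z - w)) = 0 := by
    have hlt : ∀ z ∈ Metric.sphere (0 : ℂ) r, ‖h z / w‖ < 1 := by
      intro z hz
      rw [mem_sphere_zero_iff_norm] at hz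
      rw [norm_div, div_lt_one (by linarith)]
      exact hηh z (hz ▸ hr1) (hz ▸ hr2.2)
    refine (circleIntegral.integral_congr hr0 fun z hz => ?_).trans
      (circleIntegral_logDeriv_eq_zero (F := fun z => 1 - h z / w)
        (F' := fun z => -(deriv h z / w)) hr0 (fun z hz => by
          simpa using ((hdAt z (hsubr hz)).div_const w).const_sub 1)
        fun z hz => one_sub_mem_slitPlane (hlt z hz))
    rw [one_sub_div hw0, ← neg_div, div_div_div_cancel_right₀ hw0, ← neg_sub w, div_neg, neg_div]
  -- On the outer circle (h - w)/h = 1 - w/h has a logarithm, so the winding numbers about w and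
  -- about 0 agree.
  have hcomp : (∮ z in C(0, ρ), deriv h z / (h z - w)) = ∮ z in C(0, ρ), deriv h z / h z := by
    have hlt : ∀ z ∈ Metric.sphere (0 : ℂ) ρ, ‖w‖ < ‖h z‖ := fun z hz =>
      (hδh z₀ hz₀.1 hz₀δ).trans_le (hmin hz)
    have hne0 : ∀ z ∈ Metric.sphere (0 : ℂ) ρ, h z ≠ 0 := fun z hz =>
      norm_pos_iff.1 (by linarith [hlt z hz])
    have hne : ∀ z ∈ Metric.sphere (0 : ℂ) ρ, h z - w ≠ 0 := by
      intro z hz he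
      have := hlt z hz
      rw [sub_eq_zero.1 he] at this
      exact lt_irrefl _ this
    have hdc : ContinuousOn (deriv h) (Metric.sphere 0 ρ) :=
      (hd.deriv hopen).continuousOn.mono hsub
    have hc := hd.continuousOn.mono hsub
    have hi1 : CircleIntegrable (fun z => deriv h z / (h z - w)) 0 ρ :=
      (hdc.div (hc.sub continuousOn_const) hne).circleIntegrable hρ0
    have hi2 : CircleIntegrable (fun z => deriv h z / h z) 0 ρ :=
      (hdc.div hc hne0).circleIntegrable hρ0
    rw [← sub_eq_zero, ← circleIntegral.integral_sub hi1 hi2]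
    refine (circleIntegral.integral_congr hρ0 fun z hz => ?_).trans
      (circleIntegral_logDeriv_eq_zero (F := fun z => 1 - w / h z)
        (F' := fun z => w * deriv h z / h z ^ 2) hρ0 (fun z hz => by
          have := (((hdAt z (hsub hz)).fun_inv (hne0 z hz)).const_mul w).const_sub 1
          convert! this using 1
          ring)
        fun z hz => one_sub_mem_slitPlane (by
          rw [norm_div, div_lt_one (norm_pos_iff.2 (hne0 z hz))]
          exact hlt z hz))
    have h1 := hne z hz
    have h0 := hne0 z hz
    have h2 : 1 - w / h z ≠ 0 := by
      rw [one_sub_div h0]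
      exact div_ne_zero h1 h0
    field_simp
    ring
  have e1 := hi hrR hr2.1.ne
  have e2 := hi hρ hz₀ρ.ne'
  -- The inner circle shows that k'/k has integral 0, and this integral does not depend on the
  -- radius; only the pole at z₀ contributes on the outer circle.
  rw [hzero, hin, zero_add, circleIntegral_eq_of_annulus zero_le_one hq hrR hρ] at e1
  rw [← hcomp, e2, ← e1, add_zero, hout]

/-! ### The circular mean of log‖h‖ and the growth of U at the inner circle -/

lemma circleMap_mem_annulus {r R ρ : ℝ} (hr : 0 ≤ r) (hρ : ρ ∈ Ioo r R) (t : ℝ) :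
    circleMap 0 ρ t ∈ annulus r R :=
  sphere_subset_annulus hρ (circleMap_mem_sphere 0 (hr.trans hρ.1.le) t)

lemma continuous_comp_circleMap {E : Type*} [TopologicalSpace E] {f : ℂ → E} {r R ρ : ℝ}
    (hr : 0 ≤ r) (hf : ContinuousOn f (annulus r R)) (hρ : ρ ∈ Ioo r R) :
    Continuous fun t => f (circleMap 0 ρ t) :=
  hf.comp_continuous (continuous_circleMap 0 ρ) (circleMap_mem_annulus hr hρ)

lemma hasDerivAt_log_norm {g : ℝ → ℂ} {g' : ℂ} {x : ℝ} (hg : HasDerivAt g g' x) (h0 : g x ≠ 0) :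
    HasDerivAt (fun y => Real.log ‖g y‖) (g' / g x).re x := by
  have h1 := (hg.norm_sq.log (by positivity)).const_mul (1 / 2 : ℝ)
  convert! h1 using 1
  · ext y
    rw [Real.log_pow]
    push_cast
    ring
  · rw [Complex.div_re, Complex.inner, Complex.mul_re, Complex.conj_re, Complex.conj_im,
      ← Complex.normSq_eq_norm_sq]
    ring

/-- The derivative in the radius of the circular mean of `log ‖h‖`. -/
lemma hasDerivAt_circleAverage_log_norm {r R : ℝ} (hr : 0 ≤ r) {h : ℂ → ℂ}
    (hd : DifferentiableOn ℂ h (annulus r R)) (h0 : ∀ z ∈ annulus r R, h z ≠ 0)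
    {ρ : ℝ} (hρ : ρ ∈ Ioo r R) :
    HasDerivAt (fun x => Real.circleAverage (fun z => Real.log ‖h z‖) 0 x)
      ((2 * Real.pi * Complex.I * ρ)⁻¹ * ∮ z in C(0, ρ), deriv h z / h z).re ρ := by
  have hopen := isOpen_annulus r R
  obtain ⟨s, hrs, hsρ⟩ := exists_between hρ.1
  obtain ⟨t, hρt, htR⟩ := exists_between hρ.2
  have hρ0 : (ρ : ℂ) ≠ 0 := Complex.ofReal_ne_zero.2 (by linarith)
  set q : ℂ → ℂ := fun z => deriv h z / h z with hq
  have hqc : ContinuousOn q (annulus r R) := ((hd.deriv hopen).div hd h0).continuousOn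
  have hlc : ContinuousOn (fun z => Real.log ‖h z‖) (annulus r R) :=
    hd.continuousOn.norm.log fun z hz => norm_ne_zero_iff.2 (h0 z hz)
  -- A bound for h'/h on the compact ring s ≤ |z| ≤ t is the majorant for differentiating under the
  -- integral.
  obtain ⟨C, hC⟩ := ((isCompact_closedBall (0 : ℂ) t).diff
    (Metric.isOpen_ball (x := 0) (ε := s))).exists_bound_of_continuousOn
    (hqc.mono (closedBall_diff_ball_subset_annulus hrs htR))
  have hmem : ∀ x ∈ Ioo s t, x ∈ Ioo r R := fun x hx => ⟨hrs.trans hx.1, hx.2.trans htR⟩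
  set F' : ℝ → ℝ → ℝ := fun x θ => (Complex.exp (θ * Complex.I) * q (circleMap 0 x θ)).re with hF'
  have hF'c : ∀ x ∈ Ioo s t, Continuous (F' x) := fun x hx => by
    have h1 := continuous_comp_circleMap hr hqc (hmem x hx)
    have h2 : Continuous fun θ : ℝ => Complex.exp (θ * Complex.I) := by fun_prop
    exact Complex.continuous_re.comp (h2.mul h1)
  have key := (intervalIntegral.hasDerivAt_integral_of_dominated_loc_of_deriv_le
    (μ := MeasureTheory.volume) (a := 0) (b := 2 * Real.pi)
    (F := fun x θ => Real.log ‖h (circleMap 0 x θ)‖) (F' := F') (x₀ := ρ) (s := Ioo s t)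
    (bound := fun _ => C)
    (Ioo_mem_nhds hsρ hρt) (by
      filter_upwards [Ioo_mem_nhds hsρ hρt] with x hx
      exact (continuous_comp_circleMap hr hlc (hmem x hx)).aestronglyMeasurable)
    ((continuous_comp_circleMap hr hlc hρ).intervalIntegrable _ _)
    (hF'c ρ ⟨hsρ, hρt⟩).aestronglyMeasurable
    (Eventually.of_forall fun θ _ x hx => by
      have hx0 : 0 ≤ x := by linarith [hx.1]
      refine (Complex.abs_re_le_norm _).trans ?_
      rw [norm_mul, Complex.norm_exp_ofReal_mul_I, one_mul]
      exact hC _ (by simp [abs_of_nonneg hx0, hx.1.le, hx.2.le]))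
    (continuous_const.intervalIntegrable _ _)
    (Eventually.of_forall fun θ _ x hx => by
      have hz := circleMap_mem_annulus hr (hmem x hx) θ
      have hcm : HasDerivAt (fun y : ℝ => circleMap 0 y θ) (Complex.exp (θ * Complex.I)) x := by
        simpa [circleMap] using
          (Complex.ofRealCLM.hasDerivAt (x := x)).mul_const (Complex.exp (θ * Complex.I))
      have hh := ((hd.differentiableAt (hopen.mem_nhds hz)).hasDerivAt).comp x hcm
      convert! hasDerivAt_log_norm hh (h0 _ hz) using 1
      simp only [hF', hq, Function.comp]
      congr 1
      ring)).2
  convert! key.const_mul (2 * Real.pi)⁻¹ using 1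
  rw [hF']
  have hre : ∫ θ in (0 : ℝ)..2 * Real.pi,
      (Complex.exp (θ * Complex.I) * q (circleMap 0 ρ θ)).re =
      (∫ θ in (0 : ℝ)..2 * Real.pi, Complex.exp (θ * Complex.I) * q (circleMap 0 ρ θ)).re := by
    have h1 := continuous_comp_circleMap hr hqc hρ
    have h2 : Continuous fun θ : ℝ => Complex.exp (θ * Complex.I) := by fun_prop
    exact Complex.reCLM.intervalIntegral_comp_comm ((h2.mul h1).intervalIntegrable _ _)
  rw [hre, ← Complex.re_ofReal_mul]
  congr 1
  simp only [circleIntegral]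
  rw [← intervalIntegral.integral_const_mul, ← intervalIntegral.integral_const_mul]
  refine intervalIntegral.integral_congr fun θ _ => ?_
  simp only [deriv_circleMap, circleMap_zero, smul_eq_mul, hq]
  have := Complex.I_ne_zero
  have : (Real.pi : ℂ) ≠ 0 := Complex.ofReal_ne_zero.2 Real.pi_ne_zero
  push_cast
  field_simp

lemma eventually_forall_norm_lt {h : ℂ → ℂ} {m : ℝ}
    (hlim : Tendsto (fun z : ℂ => ‖h z‖) (comap (fun z : ℂ => ‖z‖) (𝓝[>] (1 : ℝ))) (𝓝 1))
    (hm : 1 < m) : ∀ᶠ ρ in 𝓝[>] (1 : ℝ), ∀ z : ℂ, ‖z‖ = ρ → ‖h z‖ < m :=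
  eventually_comap.1 (hlim.eventually (gt_mem_nhds hm))

lemma circleIntegrable_log_norm {R : ℝ} {h : ℂ → ℂ} (hd : DifferentiableOn ℂ h (annulus 1 R))
    (hgt : ∀ z ∈ annulus 1 R, 1 < ‖h z‖)
    {ρ : ℝ} (hρ : ρ ∈ Ioo 1 R) :
    CircleIntegrable (fun z => Real.log ‖h z‖) 0 ρ :=
  ContinuousOn.circleIntegrable (zero_le_one.trans hρ.1.le)
    ((hd.continuousOn.norm.log fun z hz => by linarith [hgt z hz]).mono (sphere_subset_annulus hρ))

/-- By winding number one, both sides have radial derivative 1/ρ; their difference is a constant,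
which is 0 because ‖h‖ → 1 at the inner circle. -/
theorem circleAverage_log_norm_eq_log {R : ℝ} {h : ℂ → ℂ} (hd : DifferentiableOn ℂ h (annulus 1 R))
    (hinj : InjOn h (annulus 1 R)) (hgt : ∀ z ∈ annulus 1 R, 1 < ‖h z‖)
    (hlim : Tendsto (fun z : ℂ => ‖h z‖) (comap (fun z : ℂ => ‖z‖) (𝓝[>] (1 : ℝ))) (𝓝 1))
    {ρ : ℝ} (hρ : ρ ∈ Ioo 1 R) :
    Real.circleAverage (fun z => Real.log ‖h z‖) 0 ρ = Real.log ρ := by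
  set G : ℝ → ℝ := fun x => Real.circleAverage (fun z => Real.log ‖h z‖) 0 x - Real.log x with hG
  have hG' : ∀ x ∈ Ioo 1 R, HasDerivAt G 0 x := by
    intro x hx
    have hx0 : x ≠ 0 := by linarith [hx.1]
    have h1 := (hasDerivAt_circleAverage_log_norm zero_le_one hd
      (fun z hz => norm_pos_iff.1 (by linarith [hgt z hz])) hx).sub (Real.hasDerivAt_log hx0)
    rw [circleIntegral_logDeriv_of_injOn hd hinj hgt hlim hx, mul_inv, mul_right_comm,
      inv_mul_cancel₀ Complex.two_pi_I_ne_zero, one_mul, ← Complex.ofReal_inv, Complex.ofReal_re,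
      sub_self] at h1
    exact h1
  have hconst : ∀ x ∈ Ioo 1 R, G x = G ρ := fun x hx =>
    isOpen_Ioo.is_const_of_deriv_eq_zero isPreconnected_Ioo
      (fun y hy => (hG' y hy).differentiableAt.differentiableWithinAt)
      (fun y hy => (hG' y hy).deriv) hx hρ
  have hR : Ioo 1 R ∈ 𝓝[>] (1 : ℝ) := Ioo_mem_nhdsGT (hρ.1.trans hρ.2)
  have havg : Tendsto (fun x => Real.circleAverage (fun z => Real.log ‖h z‖) 0 x) (𝓝[>] 1)
      (𝓝 0) := by
    rw [Metric.tendsto_nhds]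
    intro ε hε
    filter_upwards [eventually_forall_norm_lt hlim (Real.one_lt_exp_iff.2 (half_pos hε)), hR]
      with x hx hx1
    have hx0 : 0 ≤ x := by linarith [hx1.1]
    have hle : ∀ z ∈ Metric.sphere (0 : ℂ) |x|,
        Real.log ‖h z‖ ≤ ε / 2 ∧ 0 ≤ Real.log ‖h z‖ := by
      intro z hz
      rw [abs_of_nonneg hx0] at hz
      have h1 := hgt z (sphere_subset_annulus hx1 hz)
      rw [mem_sphere_zero_iff_norm] at hz
      exact ⟨(Real.log_le_iff_le_exp (by linarith)).2 (hx z hz).le, Real.log_nonneg h1.le⟩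
    have h1 := Real.circleAverage_mono_on_of_le_circle (circleIntegrable_log_norm hd hgt hx1)
      fun z hz => (hle z hz).1
    have h2 := Real.circleAverage_nonneg_of_nonneg (f := fun z => Real.log ‖h z‖)
      fun z hz => (hle z hz).2
    rw [Real.dist_0_eq_abs, abs_of_nonneg h2]
    linarith
  have hlog : Tendsto Real.log (𝓝[>] 1) (𝓝 0) := by
    have := (Real.continuousAt_log one_ne_zero).tendsto
    rw [Real.log_one] at this
    exact this.mono_left nhdsWithin_le_nhds
  have h1 : Tendsto G (𝓝[>] 1) (𝓝 (0 - 0)) := havg.sub hlog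
  have h2 : Tendsto G (𝓝[>] 1) (𝓝 (G ρ)) :=
    tendsto_const_nhds.congr' (by filter_upwards [hR] with x hx using (hconst x hx).symm)
  have := tendsto_nhds_unique h1 h2
  simp only [hG] at this
  linarith

/-- With u = log‖h‖, the function ‖h‖² = exp(2u) lies between two affine functions of u, and the
mean of u is exactly log ρ. -/
lemma circularMean_sub_one_bounds {R : ℝ} {h : ℂ → ℂ} (hd : DifferentiableOn ℂ h (annulus 1 R))
    (hinj : InjOn h (annulus 1 R)) (hgt : ∀ z ∈ annulus 1 R, 1 < ‖h z‖)
    (hlim : Tendsto (fun z : ℂ => ‖h z‖) (comap (fun z : ℂ => ‖z‖) (𝓝[>] (1 : ℝ))) (𝓝 1))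
    {ε : ℝ} (hε : 0 < ε) (hR : 1 < R) :
    ∀ᶠ ρ in 𝓝[>] (1 : ℝ), Real.log (ρ ^ 2) ≤ circularMean h ρ - 1 ∧
      circularMean h ρ - 1 ≤ (1 + ε) * Real.log (ρ ^ 2) := by
  -- The bound 1/2 keeps 2u ≤ 1, where exp(2u) ≤ 1 + 2u + 4u² ≤ 1 + (2 + 4m)u; the bound ε/2 gives 2
  -- + 4m ≤ 2(1 + ε).
  set m := min (ε / 2) (1 / 2) with hm
  have hm0 : 0 < m := by positivity
  filter_upwards [eventually_forall_norm_lt hlim (Real.one_lt_exp_iff.2 hm0),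
    Ioo_mem_nhdsGT hR] with ρ hρm hρ
  have hρ0 : 0 ≤ ρ := by linarith [hρ.1]
  have hpt : ∀ z ∈ Metric.sphere (0 : ℂ) |ρ|,
      2 * Real.log ‖h z‖ + 1 ≤ ‖h z‖ ^ 2 ∧
      ‖h z‖ ^ 2 ≤ (2 + 4 * m) * Real.log ‖h z‖ + 1 := by
    intro z hz
    rw [abs_of_nonneg hρ0] at hz
    have h1 := hgt z (sphere_subset_annulus hρ hz)
    have hpos : 0 < ‖h z‖ := by linarith
    rw [mem_sphere_zero_iff_norm] at hz
    have hu : Real.log ‖h z‖ ≤ m := (Real.log_le_iff_le_exp hpos).2 (hρm z hz).le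
    have hu0 := Real.log_nonneg h1.le
    have hm2 : m ≤ 1 / 2 := min_le_right _ _
    set u := Real.log ‖h z‖ with hudef
    have he : ‖h z‖ ^ 2 = Real.exp (2 * u) := by
      rw [mul_comm, Real.exp_mul, hudef, Real.exp_log hpos]
      norm_cast
    rw [he]
    refine ⟨Real.add_one_le_exp _, ?_⟩
    have := (abs_le.1 (Real.abs_exp_sub_one_sub_id_le (x := 2 * u)
      (by rw [abs_of_nonneg (by linarith)]; linarith))).2
    nlinarith
  have hlogi := circleIntegrable_log_norm hd hgt hρ
  have hsqi : CircleIntegrable (fun z => ‖h z‖ ^ 2) 0 ρ :=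
    ContinuousOn.circleIntegrable hρ0
      ((hd.continuousOn.norm.pow 2).mono (sphere_subset_annulus hρ))
  have hlin : ∀ a : ℝ, CircleIntegrable (fun z => a * Real.log ‖h z‖ + 1) 0 ρ ∧
      Real.circleAverage (fun z => a * Real.log ‖h z‖ + 1) 0 ρ = a * Real.log ρ + 1 := by
    intro a
    have hi : CircleIntegrable (fun z => a * Real.log ‖h z‖) 0 ρ := hlogi.const_fun_smul (a := a)
    refine ⟨hi.add (circleIntegrable_const _ _ _), ?_⟩
    rw [Real.circleAverage_fun_add hi (circleIntegrable_const _ _ _), Real.circleAverage_const]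
    have := Real.circleAverage_fun_smul (a := a) (f := fun z => Real.log ‖h z‖) (c := 0) (R := ρ)
    simp only [smul_eq_mul] at this
    rw [this, circleAverage_log_norm_eq_log hd hinj hgt hlim hρ]
  have h1 := Real.circleAverage_mono (hlin 2).1 hsqi fun z hz => (hpt z hz).1
  have h2 := Real.circleAverage_mono hsqi (hlin (2 + 4 * m)).1 fun z hz => (hpt z hz).2
  rw [(hlin _).2] at h1 h2
  rw [Real.log_pow]
  have hl : 0 ≤ Real.log ρ := Real.log_nonneg hρ.1.le
  have hmε : m ≤ ε / 2 := min_le_left _ _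
  unfold circularMean
  push_cast
  constructor
  · linarith
  · nlinarith

/-! ### Parseval's identity and Laurent coefficients -/

/-- Parseval's identity for circle averages. -/
lemma hasSum_sq_norm_circleAverage {f : ℂ → ℂ} {ρ : ℝ} (hρ : 0 < ρ)
    (hf : Continuous fun t => f (circleMap 0 ρ t)) :
    HasSum (fun n : ℤ => ‖Real.circleAverage (fun z => z ^ (-n) * f z) 0 ρ‖ ^ 2 * (ρ ^ 2) ^ n)
      (Real.circleAverage (fun z => ‖f z‖ ^ 2) 0 ρ) := by
  have hab : (0 : ℝ) < 2 * Real.pi := Real.two_pi_pos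
  have hL2 : MeasureTheory.MemLp (fun t => f (circleMap 0 ρ t)) 2
      (MeasureTheory.volume.restrict (Ioc 0 (2 * Real.pi))) :=
    (MeasureTheory.memLp_two_iff_integrable_sq_norm hf.aestronglyMeasurable).2
      (hf.norm.pow 2).integrableOn_Ioc
  have key := hasSum_sq_fourierCoeffOn hab hL2
  rw [sub_zero] at key
  convert! key using 1
  ext n
  have hρn : (ρ : ℂ) ^ n ≠ 0 := zpow_ne_zero _ (Complex.ofReal_ne_zero.2 hρ.ne')
  -- The n-th Fourier coefficient on the circle is ρⁿ times the Laurent coefficient.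
  have hcoef : fourierCoeffOn hab (fun t => f (circleMap 0 ρ t)) n =
      (ρ : ℂ) ^ n * Real.circleAverage (fun z => z ^ (-n) * f z) 0 ρ := by
    rw [fourierCoeffOn_eq_integral, Real.circleAverage_def, sub_zero, one_div, mul_smul_comm,
      ← intervalIntegral.integral_const_mul]
    congr 1
    refine intervalIntegral.integral_congr fun t _ => ?_
    simp only [circleMap_zero, mul_zpow, fourier_coe_apply, smul_eq_mul]
    rw [← mul_assoc, ← mul_assoc, ← zpow_add₀ (Complex.ofReal_ne_zero.2 hρ.ne'), add_neg_cancel,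
      zpow_zero, one_mul, ← Complex.exp_int_mul]
    congr 2
    have : (Real.pi : ℂ) ≠ 0 := Complex.ofReal_ne_zero.2 Real.pi_ne_zero
    push_cast
    field_simp
  rw [hcoef, norm_mul, mul_pow, mul_comm, norm_zpow, Complex.norm_real, Real.norm_eq_abs,
    abs_of_pos hρ, ← zpow_natCast, ← zpow_natCast, ← zpow_natCast, ← zpow_mul, ← zpow_mul,
    mul_comm n]

lemma circleAverage_zpow_of_ne {n : ℤ} (hn : n ≠ 0) {ρ : ℝ} (hρ : 0 < ρ) :
    Real.circleAverage (fun z : ℂ => z ^ n) 0 ρ = 0 := by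
  rw [Real.circleAverage_eq_circleIntegral hρ.ne']
  have h1 : (∮ z in C(0, ρ), (z - 0)⁻¹ • z ^ n) = ∮ z in C(0, ρ), (z - 0) ^ (n - 1) := by
    refine circleIntegral.integral_congr hρ.le fun z hz => ?_
    have hz0 : z ≠ 0 := by
      rw [mem_sphere_zero_iff_norm] at hz
      exact norm_pos_iff.1 (hz ▸ hρ)
    simp only [sub_zero, smul_eq_mul]
    rw [zpow_sub_one₀ hz0, mul_comm]
  rw [h1, circleIntegral.integral_sub_zpow_of_ne (by omega), smul_zero]

/-- A continuous function on a circle whose Laurent coefficients of index `≠ 1` vanish is linear. -/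
lemma eq_mul_of_circleAverage_eq_zero {f : ℂ → ℂ} {ρ : ℝ} (hρ : 0 < ρ)
    (hf : Continuous fun t => f (circleMap 0 ρ t))
    (h0 : ∀ n : ℤ, n ≠ 1 → Real.circleAverage (fun z => z ^ (-n) * f z) 0 ρ = 0)
    {z : ℂ} (hz : ‖z‖ = ρ) :
    f z = Real.circleAverage (fun z => z ^ (-1 : ℤ) * f z) 0 ρ * z := by
  set l := Real.circleAverage (fun z => z ^ (-1 : ℤ) * f z) 0 ρ with hl
  set g : ℂ → ℂ := fun z => f z - l * z with hg
  have hgc : Continuous fun t => g (circleMap 0 ρ t) :=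
    hf.sub (continuous_const.mul (continuous_circleMap 0 ρ))
  have hne : ∀ z ∈ Metric.sphere (0 : ℂ) |ρ|, z ≠ 0 := fun z hz => by
    rw [mem_sphere_zero_iff_norm, abs_of_pos hρ] at hz
    exact norm_pos_iff.1 (hz ▸ hρ)
  have hcm : ∀ t, circleMap 0 ρ t ≠ 0 := fun t => circleMap_ne_center hρ.ne'
  -- Subtracting l z removes the one remaining coefficient; Parseval then makes the mean of ‖g‖²
  -- vanish.
  have hz0 : ∀ n : ℤ, Real.circleAverage (fun z => z ^ (-n) * g z) 0 ρ = 0 := by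
    intro n
    have hcont : ∀ k : ℤ, Continuous fun t => circleMap 0 ρ t ^ k := fun k =>
      (continuous_circleMap 0 ρ).zpow₀ k fun t => Or.inl (hcm t)
    have hsplit : Real.circleAverage (fun z => z ^ (-n) * g z) 0 ρ =
        Real.circleAverage (fun z => z ^ (-n) * f z) 0 ρ -
          l * Real.circleAverage (fun z => z ^ (1 - n)) 0 ρ := by
      rw [← smul_eq_mul l, ← Real.circleAverage_fun_smul, ← Real.circleAverage_fun_sub]
      · refine Real.circleAverage_congr_sphere fun z hz => ?_
        have := hne z hz
        simp only [hg, smul_eq_mul]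
        rw [sub_eq_add_neg 1 n, zpow_add₀ this, zpow_one]
        ring
      · exact ((hcont (-n)).mul hf).intervalIntegrable _ _
      · exact (continuous_const.mul (hcont (1 - n))).intervalIntegrable _ _
    rw [hsplit]
    rcases eq_or_ne n 1 with rfl | hn
    · simp only [sub_self, zpow_zero, Real.circleAverage_const, mul_one, ← hl]
    · rw [h0 n hn, circleAverage_zpow_of_ne (by omega) hρ, mul_zero, sub_zero]
  have hP := hasSum_sq_norm_circleAverage hρ hgc
  simp only [hz0, norm_zero, ne_eq, OfNat.ofNat_ne_zero, not_false_eq_true, zero_pow, zero_mul]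
    at hP
  have hint := hP.unique hasSum_zero
  rw [Real.circleAverage_def, smul_eq_mul, mul_eq_zero,
    or_iff_right (inv_ne_zero Real.two_pi_pos.ne')] at hint
  obtain ⟨t, ht, rfl⟩ : z ∈ circleMap 0 ρ '' Ioc 0 (2 * Real.pi) := by
    rw [image_circleMap_Ioc, abs_of_pos hρ, mem_sphere_zero_iff_norm, hz]
  by_contra hne'
  have hpos := intervalIntegral.integral_pos (f := fun t => ‖g (circleMap 0 ρ t)‖ ^ 2)
    Real.two_pi_pos (hgc.norm.pow 2).continuousOn (fun _ _ => by positivity)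
    ⟨t, Ioc_subset_Icc_self ht, pow_pos (norm_pos_iff.2 (sub_ne_zero.2 hne')) 2⟩
  exact hpos.ne' hint

/-! ### Smoothness, and convexity of normalized series -/

lemma contDiffOn_laurentSum {a b : ℝ} (ha : 0 ≤ a) (k : ℕ) : ∀ {c : ℤ → ℝ},
    (∀ y ∈ Ioo a b, Summable fun n => c n * y ^ n) → ContDiffOn ℝ k (laurentSum c) (Ioo a b) := by
  induction k with
  | zero =>
    intro c hc
    exact contDiffOn_zero.2 fun x hx =>
      (hasDerivAt_laurentSum ha hc hx).continuousAt.continuousWithinAt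
  | succ k ih =>
    intro c hc
    push_cast
    rw [contDiffOn_succ_iff_deriv_of_isOpen isOpen_Ioo]
    refine ⟨fun x hx => (hasDerivAt_laurentSum ha hc hx).differentiableAt.differentiableWithinAt,
      by simp, ?_⟩
    exact (ih fun y hy => summable_laurentDeriv ha hc hy).congr fun x hx =>
      (hasDerivAt_laurentSum ha hc hx).deriv

/-- A two-sided power series with nonnegative coefficients whose value and slope at `1` equal `1`. -/
structure IsNormalized (c : ℤ → ℝ) (B : ℝ) : Prop where
  one_lt : 1 < B
  nonneg : ∀ n, 0 ≤ c n
  summable : ∀ x ∈ Ioo 1 B, Summable fun n => c n * x ^ n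
  bounds : ∀ ε > 0, ∀ᶠ x in 𝓝[>] (1 : ℝ),
    Real.log x ≤ laurentSum c x - 1 ∧ laurentSum c x - 1 ≤ (1 + ε) * Real.log x

namespace IsNormalized

variable {c : ℤ → ℝ} {B : ℝ}

lemma hasDerivAt (hc : IsNormalized c B) {x : ℝ} (hx : x ∈ Ioo 1 B) :
    HasDerivAt (laurentSum c) (laurentSum (laurentDeriv c) x) x :=
  hasDerivAt_laurentSum zero_le_one hc.summable hx

lemma summable_deriv (hc : IsNormalized c B) {x : ℝ} (hx : x ∈ Ioo 1 B) :
    Summable fun n => laurentDeriv c n * x ^ n :=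
  summable_laurentDeriv zero_le_one hc.summable hx

lemma hasDerivAt_deriv (hc : IsNormalized c B) {x : ℝ} (hx : x ∈ Ioo 1 B) :
    HasDerivAt (laurentSum (laurentDeriv c)) (laurentSum (laurentDeriv (laurentDeriv c)) x) x :=
  hasDerivAt_laurentSum zero_le_one (fun _ hy => hc.summable_deriv hy) hx

lemma second_deriv_nonneg (hc : IsNormalized c B) {x : ℝ} (hx : x ∈ Ioo 1 B) :
    0 ≤ laurentSum (laurentDeriv (laurentDeriv c)) x :=
  laurentSum_nonneg (laurentDeriv_laurentDeriv_nonneg hc.nonneg) (zero_le_one.trans hx.1.le)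

lemma monotoneOn_deriv (hc : IsNormalized c B) :
    MonotoneOn (laurentSum (laurentDeriv c)) (Ioo 1 B) := by
  refine monotoneOn_of_deriv_nonneg (convex_Ioo 1 B)
    (fun x hx => (hc.hasDerivAt_deriv hx).continuousAt.continuousWithinAt) ?_ ?_
  · rw [interior_Ioo]
    exact fun x hx => (hc.hasDerivAt_deriv hx).differentiableAt.differentiableWithinAt
  · rw [interior_Ioo]
    intro x hx
    rw [(hc.hasDerivAt_deriv hx).deriv]
    exact hc.second_deriv_nonneg hx

lemma Ioo_mem (hc : IsNormalized c B) : Ioo 1 B ∈ 𝓝[>] (1 : ℝ) := Ioo_mem_nhdsGT hc.one_lt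

lemma tendsto_one (hc : IsNormalized c B) : Tendsto (laurentSum c) (𝓝[>] 1) (𝓝 1) := by
  have hlog : Tendsto Real.log (𝓝[>] 1) (𝓝 0) := by
    have := (Real.continuousAt_log one_ne_zero).tendsto
    rw [Real.log_one] at this
    exact this.mono_left nhdsWithin_le_nhds
  have h1 := hlog.const_add 1
  have h2 := (hlog.const_mul (1 + 1)).const_add 1
  rw [mul_zero, add_zero] at h2
  rw [add_zero] at h1
  refine tendsto_of_tendsto_of_tendsto_of_le_of_le' h1 h2 ?_ ?_
  · filter_upwards [hc.bounds 1 one_pos] with x hx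
    linarith [hx.1]
  · filter_upwards [hc.bounds 1 one_pos] with x hx
    linarith [hx.2]

/-- The series need not converge at 1, so the mean value theorem is applied after redefining the
value there as the limit 1. -/
lemma exists_deriv_eq_slope (hc : IsNormalized c B) {x : ℝ} (hx : x ∈ Ioo 1 B) :
    ∃ ξ ∈ Ioo 1 x, laurentSum (laurentDeriv c) ξ = (laurentSum c x - 1) / (x - 1) := by
  have hev : ∀ y ∈ Ioo 1 B, Function.update (laurentSum c) 1 1 =ᶠ[𝓝 y] laurentSum c := by
    intro y hy
    filter_upwards [isOpen_Ioo.mem_nhds hy] with t ht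
    exact Function.update_of_ne ht.1.ne' _ _
  have hcont : ContinuousOn (Function.update (laurentSum c) 1 1) (Icc 1 x) := by
    intro y hy
    rcases hy.1.eq_or_lt with rfl | h1
    · rw [continuousWithinAt_update_same]
      exact hc.tendsto_one.mono_left (nhdsWithin_mono _ fun t ht =>
        lt_of_le_of_ne ht.1.1 (Ne.symm ht.2))
    · have hy' : y ∈ Ioo 1 B := ⟨h1, hy.2.trans_lt hx.2⟩
      exact ((hc.hasDerivAt hy').congr_of_eventuallyEq
        (hev y hy')).continuousAt.continuousWithinAt
  obtain ⟨ξ, hξ, he⟩ := exists_hasDerivAt_eq_slope (Function.update (laurentSum c) 1 1)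
    (laurentSum (laurentDeriv c)) hx.1 hcont fun y hy =>
      (hc.hasDerivAt ⟨hy.1, hy.2.trans hx.2⟩).congr_of_eventuallyEq (hev y ⟨hy.1, hy.2.trans hx.2⟩)
  refine ⟨ξ, hξ, ?_⟩
  rw [he, Function.update_self, Function.update_of_ne hx.1.ne']

/-- Slopes from 1 are controlled by `bounds`, and monotonicity passes from slopes to derivatives.
From below, the derivative at x is at least the slope, which is at least log x / (x - 1) ≥ 1/x. From
above, a single point ξ with derivative below a controls all points to its left. -/
lemma tendsto_deriv_one (hc : IsNormalized c B) :
    Tendsto (laurentSum (laurentDeriv c)) (𝓝[>] 1) (𝓝 1) := by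
  rw [tendsto_order]
  constructor
  · intro a ha
    have hinv : Tendsto (fun x : ℝ => x⁻¹) (𝓝[>] 1) (𝓝 1) := by
      have := (tendsto_inv₀ (one_ne_zero (α := ℝ)))
      rw [inv_one] at this
      exact this.mono_left nhdsWithin_le_nhds
    filter_upwards [hinv.eventually (lt_mem_nhds ha), hc.bounds 1 one_pos, hc.Ioo_mem]
      with x hx1 hx2 hx
    obtain ⟨ξ, hξ, he⟩ := hc.exists_deriv_eq_slope hx
    refine hx1.trans_le (le_trans ?_ (hc.monotoneOn_deriv ⟨hξ.1, hξ.2.trans hx.2⟩ hx hξ.2.le))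
    have hx0 : 0 < x := by linarith [hx.1]
    rw [he, le_div_iff₀ (by linarith [hx.1])]
    refine le_trans (le_of_eq ?_) ((Real.one_sub_inv_le_log_of_pos hx0).trans hx2.1)
    field_simp
  · intro a ha
    obtain ⟨x, hx2, hx⟩ := ((hc.bounds ((a - 1) / 2) (by linarith)).and hc.Ioo_mem).exists
    obtain ⟨ξ, hξ, he⟩ := hc.exists_deriv_eq_slope hx
    have hx0 : 0 < x := by linarith [hx.1]
    have hlt : laurentSum (laurentDeriv c) ξ < a := by
      rw [he, div_lt_iff₀ (by linarith [hx.1])]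
      have := Real.log_le_sub_one_of_pos hx0
      calc laurentSum c x - 1 ≤ (1 + (a - 1) / 2) * Real.log x := hx2.2
        _ ≤ (1 + (a - 1) / 2) * (x - 1) := by gcongr
        _ < a * (x - 1) := mul_lt_mul_of_pos_right (by linarith) (by linarith [hx.1])
    filter_upwards [Ioo_mem_nhdsGT hξ.1] with t ht
    exact (hc.monotoneOn_deriv ⟨ht.1, (ht.2.trans hξ.2).trans hx.2⟩ ⟨hξ.1, hξ.2.trans hx.2⟩
      ht.2.le).trans_lt hlt

lemma one_le_deriv (hc : IsNormalized c B) {x : ℝ} (hx : x ∈ Ioo 1 B) :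
    1 ≤ laurentSum (laurentDeriv c) x := by
  refine le_of_tendsto hc.tendsto_deriv_one ?_
  filter_upwards [Ioo_mem_nhdsGT hx.1] with t ht
  exact hc.monotoneOn_deriv ⟨ht.1, ht.2.trans hx.2⟩ hx ht.2.le

lemma le_laurentSum (hc : IsNormalized c B) {x : ℝ} (hx : x ∈ Ioo 1 B) : x ≤ laurentSum c x := by
  obtain ⟨ξ, hξ, he⟩ := hc.exists_deriv_eq_slope hx
  have h1 := hc.one_le_deriv ⟨hξ.1, hξ.2.trans hx.2⟩
  rw [he, le_div_iff₀ (by linarith [hx.1])] at h1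
  linarith

/-- If the second derivative vanishes at a point, the series is the function `x ↦ x`. -/
lemma eq_single_of_second_deriv_eq_zero (hc : IsNormalized c B) {x : ℝ} (hx : x ∈ Ioo 1 B)
    (h0 : laurentSum (laurentDeriv (laurentDeriv c)) x = 0) : c = Pi.single 1 1 := by
  have hz : ∀ n : ℤ, n ≠ 0 → n ≠ 1 → c n = 0 := fun n =>
    eq_zero_of_laurentSum_laurentDeriv_laurentDeriv_eq_zero hc.nonneg
      (zero_lt_one.trans hx.1)
      (summable_laurentDeriv zero_le_one (fun _ hy => hc.summable_deriv hy) hx) h0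
  have hQ : ∀ y, laurentSum (laurentDeriv c) y = c 1 := by
    intro y
    rw [laurentSum, tsum_eq_single 0]
    · simp [laurentDeriv]
    · intro n hn
      rcases eq_or_ne (n + 1) 0 with h | h
      · simp [laurentDeriv, h]
      · rw [laurentDeriv, hz (n + 1) h (by omega), mul_zero, zero_mul]
  have hW : ∀ y, laurentSum c y = c 0 + c 1 * y := by
    intro y
    rw [laurentSum, tsum_eq_sum (s := {0, 1})]
    · simp
    · intro n hn
      simp only [Finset.mem_insert, Finset.mem_singleton, not_or] at hn
      rw [hz n hn.1 hn.2, zero_mul]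
  -- The sum is now c 0 + c 1 y; its limiting slope and value at 1 determine both coefficients.
  have h1 : c 1 = 1 := by
    have := hc.tendsto_deriv_one
    simp only [funext hQ] at this
    exact tendsto_nhds_unique tendsto_const_nhds this
  have hc0 : c 0 = 0 := by
    have h2 := hc.tendsto_one
    rw [funext hW, h1] at h2
    have h3 : Tendsto (fun y : ℝ => c 0 + 1 * y) (𝓝[>] 1) (𝓝 (c 0 + 1 * 1)) :=
      (Continuous.tendsto (by fun_prop) 1).mono_left nhdsWithin_le_nhds
    have := tendsto_nhds_unique h2 h3
    linarith
  ext n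
  rcases eq_or_ne n 1 with rfl | hn1
  · simp [h1]
  · rw [Pi.single_eq_of_ne hn1]
    rcases eq_or_ne n 0 with rfl | hn0
    · exact hc0
    · exact hz n hn0 hn1

/-- The increasing derivative is squeezed between 1 and its value at x, hence constant on (1, x), so
the second derivative vanishes there. -/
lemma eq_single_of_deriv_eq_one (hc : IsNormalized c B) {x : ℝ} (hx : x ∈ Ioo 1 B)
    (h0 : laurentSum (laurentDeriv c) x = 1) : c = Pi.single 1 1 := by
  have hconst : ∀ t ∈ Ioo 1 x, laurentSum (laurentDeriv c) t = 1 := fun t ht => by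
    have ht' : t ∈ Ioo 1 B := ⟨ht.1, ht.2.trans hx.2⟩
    exact le_antisymm (h0 ▸ hc.monotoneOn_deriv ht' hx ht.2.le) (hc.one_le_deriv ht')
  obtain ⟨t, ht⟩ := exists_between hx.1
  have ht' : t ∈ Ioo 1 B := ⟨ht.1, ht.2.trans hx.2⟩
  refine hc.eq_single_of_second_deriv_eq_zero ht' ((hc.hasDerivAt_deriv ht').unique ?_)
  refine (hasDerivAt_const t (1 : ℝ)).congr_of_eventuallyEq ?_
  filter_upwards [isOpen_Ioo.mem_nhds ht] with y hy using hconst y hy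

lemma eq_single_of_laurentSum_eq (hc : IsNormalized c B) {x : ℝ} (hx : x ∈ Ioo 1 B)
    (h0 : laurentSum c x = x) : c = Pi.single 1 1 := by
  obtain ⟨ξ, hξ, he⟩ := hc.exists_deriv_eq_slope hx
  refine hc.eq_single_of_deriv_eq_one ⟨hξ.1, hξ.2.trans hx.2⟩ ?_
  rw [he, h0, div_self (by linarith [hx.1])]

end IsNormalized

/-! ### From the map h to its normalized series -/

lemma HomeoClass.injOn {R : ℝ} {h : ℂ → ℂ} (hh : HomeoClass R h) : InjOn h (annulus 1 R) := by
  obtain ⟨Ω, -, ⟨e, he⟩, -, -⟩ := hh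
  intro z hz w hw hzw
  have : e ⟨z, hz⟩ = e ⟨w, hw⟩ := Subtype.ext (by rw [he, he]; exact hzw)
  exact congrArg Subtype.val (e.injective this)

lemma HomeoClass.one_lt_norm {R : ℝ} {h : ℂ → ℂ} (hh : HomeoClass R h) {z : ℂ}
    (hz : z ∈ annulus 1 R) : 1 < ‖h z‖ := by
  obtain ⟨Ω, ⟨-, -, L, -, -, -, -, hL⟩, ⟨e, he⟩, -, -⟩ := hh
  by_contra! hle
  have h1 : (h z : OnePoint ℂ) ∈ ((fun w : ℂ => (w : OnePoint ℂ)) '' Ω)ᶜ := by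
    rw [hL]
    exact Or.inl ⟨h z, by simpa using hle, rfl⟩
  exact h1 ⟨h z, by rw [← he ⟨z, hz⟩]; exact (e ⟨z, hz⟩).2, rfl⟩

lemma HomeoClass.tendsto_norm {R : ℝ} {h : ℂ → ℂ} (hh : HomeoClass R h) :
    Tendsto (fun z : ℂ => ‖h z‖) (comap (fun z : ℂ => ‖z‖) (𝓝[>] (1 : ℝ))) (𝓝 1) := by
  obtain ⟨Ω, -, -, -, hl⟩ := hh
  exact hl

/-- The squared absolute values of the Laurent coefficients of `h`, computed on `|z| = s`. -/
noncomputable def sqCoeff (h : ℂ → ℂ) (s : ℝ) (n : ℤ) : ℝ :=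
  ‖Real.circleAverage (fun z => z ^ (-n) * h z) 0 s‖ ^ 2

/-- This radius independence lets the coefficients computed on one circle |z| = s serve for every ρ.
-/
lemma circleAverage_zpow_mul_eq {R : ℝ} {h : ℂ → ℂ} (hd : DifferentiableOn ℂ h (annulus 1 R))
    {s t : ℝ} (hs : s ∈ Ioo 1 R) (ht : t ∈ Ioo 1 R) (n : ℤ) :
    Real.circleAverage (fun z => z ^ n * h z) 0 s =
      Real.circleAverage (fun z => z ^ n * h z) 0 t := by
  refine circleAverage_eq_of_annulus zero_le_one (fun z hz => ?_) hs ht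
  have h0 : z ≠ 0 := norm_pos_iff.1 (zero_lt_one.trans hz.1)
  exact (differentiableAt_zpow.2 (Or.inl h0)).differentiableWithinAt.fun_mul (hd z hz)

lemma hasSum_circularMean {R : ℝ} {h : ℂ → ℂ} (hd : DifferentiableOn ℂ h (annulus 1 R))
    {s ρ : ℝ} (hs : s ∈ Ioo 1 R) (hρ : ρ ∈ Ioo 1 R) :
    HasSum (fun n => sqCoeff h s n * (ρ ^ 2) ^ n) (circularMean h ρ) := by
  simp only [sqCoeff, circleAverage_zpow_mul_eq hd hs hρ]
  exact hasSum_sq_norm_circleAverage (zero_lt_one.trans hρ.1)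
    (continuous_comp_circleMap zero_le_one hd.continuousOn hρ)

lemma isRotationOn_of_sqCoeff_eq {R : ℝ} {h : ℂ → ℂ} (hd : DifferentiableOn ℂ h (annulus 1 R))
    {s : ℝ} (hs : s ∈ Ioo 1 R) (hc : sqCoeff h s = Pi.single 1 1) : IsRotationOn R h := by
  refine ⟨Real.circleAverage (fun z => z ^ (-1 : ℤ) * h z) 0 s, ?_, fun z hz => ?_⟩
  · have := congrFun hc 1
    rw [Pi.single_eq_same, sqCoeff] at this
    exact (pow_eq_one_iff_of_nonneg (norm_nonneg _) two_ne_zero).1 this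
  · have hz' : ‖z‖ ∈ Ioo 1 R := hz
    rw [circleAverage_zpow_mul_eq hd hs hz']
    refine eq_mul_of_circleAverage_eq_zero (zero_lt_one.trans hz.1)
      (continuous_comp_circleMap zero_le_one hd.continuousOn hz') (fun n hn => ?_) rfl
    have := congrFun hc n
    rw [Pi.single_eq_of_ne hn, sqCoeff, sq_eq_zero_iff, norm_eq_zero] at this
    rw [circleAverage_zpow_mul_eq hd hz' hs, this]

lemma IsRotationOn.circularMean_eq {R : ℝ} {h : ℂ → ℂ} (hh : IsRotationOn R h) {ρ : ℝ}
    (hρ : ρ ∈ Ioo 1 R) : circularMean h ρ = ρ ^ 2 := by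
  obtain ⟨l, hl, hrot⟩ := hh
  refine Real.circleAverage_const_on_circle fun z hz => ?_
  rw [abs_of_pos (zero_lt_one.trans hρ.1)] at hz
  rw [hrot z (sphere_subset_annulus hρ hz), norm_mul, hl, one_mul, mem_sphere_zero_iff_norm.1 hz]

lemma sq_mem_Ioo {R ρ : ℝ} (hρ : ρ ∈ Ioo 1 R) : ρ ^ 2 ∈ Ioo 1 (R ^ 2) :=
  ⟨by nlinarith [hρ.1], by nlinarith [hρ.1, hρ.2]⟩

lemma sqrt_mem_Ioo {R x : ℝ} (hR : 1 < R) (hx : x ∈ Ioo 1 (R ^ 2)) : √x ∈ Ioo 1 R :=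
  ⟨Real.lt_sqrt_of_sq_lt (by simpa using hx.1), (Real.sqrt_lt' (by linarith)).2 hx.2⟩

lemma circularMean_eq_laurentSum {R : ℝ} {h : ℂ → ℂ} (hd : DifferentiableOn ℂ h (annulus 1 R))
    {s ρ : ℝ} (hs : s ∈ Ioo 1 R) (hρ : ρ ∈ Ioo 1 R) :
    circularMean h ρ = laurentSum (sqCoeff h s) (ρ ^ 2) :=
  (hasSum_circularMean hd hs hρ).tsum_eq.symm

lemma isNormalized_sqCoeff {R : ℝ} {h : ℂ → ℂ} (hh : HomeoClass R h)
    (hd : DifferentiableOn ℂ h (annulus 1 R)) {s : ℝ} (hs : s ∈ Ioo 1 R) :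
    IsNormalized (sqCoeff h s) (R ^ 2) := by
  have hR : 1 < R := hs.1.trans hs.2
  refine ⟨by nlinarith, fun n => sq_nonneg _, fun x hx => ?_, fun ε hε => ?_⟩
  · have := (hasSum_circularMean hd hs (sqrt_mem_Ioo hR hx)).summable
    rwa [Real.sq_sqrt (by linarith [hx.1])] at this
  · have hsqrt : Tendsto Real.sqrt (𝓝[>] 1) (𝓝[>] 1) := by
      refine tendsto_nhdsWithin_iff.2 ⟨?_, ?_⟩
      · have := (Real.continuous_sqrt.tendsto 1).mono_left (nhdsWithin_le_nhds (s := Ioi 1))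
        rwa [Real.sqrt_one] at this
      · filter_upwards [self_mem_nhdsWithin] with x hx
        exact Real.lt_sqrt_of_sq_lt (by simpa using hx)
    filter_upwards [hsqrt.eventually (circularMean_sub_one_bounds hd hh.injOn
      (fun z hz => hh.one_lt_norm hz) hh.tendsto_norm hε hR),
      Ioo_mem_nhdsGT (show 1 < R ^ 2 by nlinarith)] with x hx hxm
    rwa [circularMean_eq_laurentSum hd hs (sqrt_mem_Ioo hR hxm),
      Real.sq_sqrt (by linarith [hxm.1])] at hx

end CircleEvolution

/-! ### Assembly through U(ρ) = W(ρ²) -/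

theorem proposition3p1 (R : ℝ) (hR : 1 < R) (h : ℂ → ℂ)
    (hclass : CircleEvolution.HomeoClass R h)
    (hconf : DifferentiableOn ℂ h (CircleEvolution.annulus 1 R)) :
    CircleEvolution.HasInitialSpeed h 1 ∧
    ContDiffOn ℝ 2 (CircleEvolution.circularMean h) (Set.Ioo 1 R) ∧
    ∀ ρ ∈ Set.Ioo 1 R,
      (ρ ^ 2 ≤ CircleEvolution.circularMean h ρ ∧
        2 * ρ ≤ deriv (CircleEvolution.circularMean h) ρ ∧
        2 ≤ deriv (deriv (CircleEvolution.circularMean h)) ρ) ∧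
      (CircleEvolution.circularMean h ρ = ρ ^ 2 ↔ CircleEvolution.IsRotationOn R h) ∧
      (deriv (CircleEvolution.circularMean h) ρ = 2 * ρ ↔ CircleEvolution.IsRotationOn R h) ∧
      (deriv (deriv (CircleEvolution.circularMean h)) ρ = 2 ↔
        CircleEvolution.IsRotationOn R h) := by
  open CircleEvolution in
  obtain ⟨s, hs⟩ := exists_between hR
  have hN := isNormalized_sqCoeff hclass hconf hs
  set c := sqCoeff h s with hc
  have hU : ∀ ρ ∈ Ioo 1 R, circularMean h ρ = laurentSum c (ρ ^ 2) := fun ρ hρ =>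
    circularMean_eq_laurentSum hconf hs hρ
  have hU1 : ∀ ρ ∈ Ioo 1 R,
      HasDerivAt (circularMean h) (2 * ρ * laurentSum (laurentDeriv c) (ρ ^ 2)) ρ := by
    intro ρ hρ
    have h1 := HasDerivAt.comp (h := fun x => x ^ 2) ρ (hN.hasDerivAt (sq_mem_Ioo hρ))
      (hasDerivAt_pow 2 ρ)
    have h2 := h1.congr_of_eventuallyEq (f₁ := circularMean h)
      (by filter_upwards [isOpen_Ioo.mem_nhds hρ] with x hx using hU x hx)
    convert! h2 using 1
    push_cast
    ring
  have hU2 : ∀ ρ ∈ Ioo 1 R, HasDerivAt (deriv (circularMean h))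
      (2 * laurentSum (laurentDeriv c) (ρ ^ 2) +
        4 * ρ ^ 2 * laurentSum (laurentDeriv (laurentDeriv c)) (ρ ^ 2)) ρ := by
    intro ρ hρ
    have h1 := ((hasDerivAt_id ρ).const_mul 2).mul
      (HasDerivAt.comp (h := fun x => x ^ 2) ρ (hN.hasDerivAt_deriv (sq_mem_Ioo hρ))
        (hasDerivAt_pow 2 ρ))
    have h2 := h1.congr_of_eventuallyEq (f₁ := deriv (circularMean h))
      (by filter_upwards [isOpen_Ioo.mem_nhds hρ] with x hx using (hU1 x hx).deriv)
    convert! h2 using 1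
    simp only [id, Function.comp]
    push_cast
    ring
  refine ⟨⟨?_, ?_⟩, ?_, fun ρ hρ => ?_⟩
  · filter_upwards [Ioo_mem_nhdsGT hR] with ρ hρ
    have hpos : 0 < circularMean h ρ := by
      rw [hU ρ hρ]
      have := hN.le_laurentSum (sq_mem_Ioo hρ)
      nlinarith [hρ.1]
    exact ((hU1 ρ hρ).sqrt hpos.ne').differentiableAt
  · have hsq : Tendsto (fun x : ℝ => x ^ 2) (𝓝[>] 1) (𝓝[>] 1) := by
      refine tendsto_nhdsWithin_iff.2 ⟨?_, ?_⟩
      · have := ((continuous_pow 2).tendsto (1 : ℝ)).mono_left (nhdsWithin_le_nhds (s := Ioi 1))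
        rwa [one_pow] at this
      · filter_upwards [self_mem_nhdsWithin] with x hx
        exact one_lt_pow₀ (mem_Ioi.1 hx) two_ne_zero
    have hid : Tendsto (fun x : ℝ => x) (𝓝[>] 1) (𝓝 1) :=
      tendsto_id.mono_left nhdsWithin_le_nhds
    -- This is the limit of U' / (2√U), written through the series at ρ².
    have hlim := ((hid.const_mul 2).mul (hN.tendsto_deriv_one.comp hsq)).div
      ((hN.tendsto_one.comp hsq).sqrt.const_mul 2) (by simp)
    simp only [Real.sqrt_one, mul_one, div_self (two_ne_zero (α := ℝ))] at hlim
    refine hlim.congr' ?_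
    filter_upwards [Ioo_mem_nhdsGT hR] with ρ hρ
    have hpos : 0 < circularMean h ρ := by
      rw [hU ρ hρ]
      have := hN.le_laurentSum (sq_mem_Ioo hρ)
      nlinarith [hρ.1]
    have h1 := ((hU1 ρ hρ).sqrt hpos.ne').deriv
    simp only [Function.comp, Pi.div_apply]
    rw [← hU ρ hρ]
    exact h1.symm
  · have h1 : ContDiffOn ℝ 2 (laurentSum c) (Ioo 1 (R ^ 2)) :=
      contDiffOn_laurentSum zero_le_one 2 hN.summable
    exact (h1.comp (contDiff_id.pow 2).contDiffOn fun x hx => sq_mem_Ioo hx).congr hU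
  · have hx := sq_mem_Ioo hρ
    have hρ0 : 0 < ρ := zero_lt_one.trans hρ.1
    have hQ := hN.one_le_deriv hx
    have hW2 := hN.second_deriv_nonneg hx
    have hW2' : 0 ≤ 4 * ρ ^ 2 * laurentSum (laurentDeriv (laurentDeriv c)) (ρ ^ 2) := by
      positivity
    have hrot1 : IsRotationOn R h → ∀ x ∈ Ioo 1 R, deriv (circularMean h) x = 2 * x := by
      intro hr x hx
      have h1 := (hasDerivAt_pow 2 x).congr_of_eventuallyEq (f₁ := circularMean h)
        (by filter_upwards [isOpen_Ioo.mem_nhds hx] with y hy using hr.circularMean_eq hy)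
      simpa using h1.deriv
    rw [(hU1 ρ hρ).deriv, (hU2 ρ hρ).deriv, hU ρ hρ]
    refine ⟨⟨hN.le_laurentSum hx, ?_, by linarith⟩, ⟨fun he => ?_, fun hr => ?_⟩,
      ⟨fun he => ?_, fun hr => ?_⟩, ⟨fun he => ?_, fun hr => ?_⟩⟩
    · exact le_mul_of_one_le_right (by positivity) hQ
    · exact isRotationOn_of_sqCoeff_eq hconf hs (hN.eq_single_of_laurentSum_eq hx he)
    · rw [← hU ρ hρ, hr.circularMean_eq hρ]
    · refine isRotationOn_of_sqCoeff_eq hconf hs (hN.eq_single_of_deriv_eq_one hx ?_)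
      exact (mul_eq_left₀ (by positivity)).1 he
    · rw [← (hU1 ρ hρ).deriv, hrot1 hr ρ hρ]
    -- In U'' = 2W' + 4ρ²W'' the first summand is at least 2 and the second at least 0, so U'' = 2
    -- forces W' = 1.
    · refine isRotationOn_of_sqCoeff_eq hconf hs (hN.eq_single_of_deriv_eq_one hx ?_)
      linarith
    · rw [← (hU2 ρ hρ).deriv]
      have h1 := ((hasDerivAt_id ρ).const_mul 2).congr_of_eventuallyEq
        (f₁ := deriv (circularMean h))
        (by filter_upwards [isOpen_Ioo.mem_nhds hρ] with y hy using hrot1 hr y hy)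
      simpa using h1.deriv
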